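/- A \emph{group isogeny} is a group homomorphism $f\colon H\to G$ with $\#\ker f<\infty$ and $(G:fH)<\infty$; its index is $\mathrm{i}(f)=(G:fH)/\#\ker f$. A \emph{commensurability} $c=(W,f,g)\colon X\rightleftharpoons Y$ of groups consists of a group $W$ and isogenies $f\colon W\to X$, $g\colon W\to Y$; its index is $\mathrm{i}(c)=\mathrm{i}(g)/\mathrm{i}(f)$. Commensurabilities of abelian groups are defined in the same way, with $W$ abelian. For a commensurability $c=(W,f,g)\colon L\rightleftharpoons M$ of abelian groups let $\operatorname{End} c$ be the ring of triples $(\lambda,\nu,\mu)\in\operatorname{End}L\times\operatorname{End}W\times\operatorname{End}M$ with $\lambda f=f\nu$ and $\mu g=g\nu$, let $\operatorname{Aut}c=(\operatorname{End}c)^\times$, and let $\mathrm{a}(c)$ be the triple consisting of $\operatorname{Aut}c$ and the projections $\operatorname{Aut}c\to\operatorname{Aut}L$, $\operatorname{Aut}c\to\operatorname{Aut}M$. When $L$ and $M$ are finitely generated, put $\mathrm{ia}(L,M)=\mathrm{i}(\mathrm{a}(c))$ for any commensurability $c\colon L\rightleftharpoons M$, if there is one; this is well defined, i.e. $\mathrm{a}(c)$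 is a group commensurability and $\mathrm{i}(\mathrm{a}(c))$ does not depend on the choice of $c$. Let $L$ and $M$ be finitely generated abelian groups. Then: (a) there exists a commensurability $L\rightleftharpoons M$ if and only if $L$ and $M$ have the same rank; (b) if $L\cong\mathbb{Z}^n\oplus L_0$ and $M\cong\mathbb{Z}^n\oplus M_0$, where $n\ge 0$ and $L_0$ and $M_0$ are finite abelian groups, then $$\mathrm{ia}(L,M)=\frac{(\#M_0)^n\cdot\#\operatorname{Aut}M_0}{(\#L_0)^n\cdot\#\operatorname{Aut}L_0}.$$ -/

import Mathlib

universe u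

namespace Commens

/-- A group isogeny: a homomorphism with finite kernel whose image has finite index. -/
def IsIsogeny {H G : Type*} [Group H] [Group G] (f : H →* G) : Prop :=
  Finite f.ker ∧ f.range.FiniteIndex

/-- The index `(G : f H) / #ker f` of an isogeny `f : H → G`. -/
noncomputable def isogenyIndex {H G : Type*} [Group H] [Group G] (f : H →* G) : ℚ :=
  (f.range.index : ℚ) / (Nat.card f.ker : ℚ)

/-- An isogeny of abelian groups: finite kernel and image of finite index. -/
def IsAddIsogeny {H G : Type*} [AddCommGroup H] [AddCommGroup G] (f : H →+ G) : Prop :=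
  Finite f.ker ∧ f.range.FiniteIndex

/-- A correspondence `X ← W → Y` of groups. -/
structure GroupCorrespondence (X Y : Type u) [Group X] [Group Y] where
  W : Type u
  [group : Group W]
  left : W →* X
  right : W →* Y

attribute [instance] GroupCorrespondence.group

namespace GroupCorrespondence

variable {X Y : Type u} [Group X] [Group Y]

/-- A group commensurability: both legs are isogenies. -/
def IsCommensurability (c : GroupCorrespondence X Y) : Prop :=
  IsIsogeny c.left ∧ IsIsogeny c.right

/-- The index `i(right) / i(left)` of a group commensurability. -/
noncomputable def index (c : GroupCorrespondence X Y) : ℚ :=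
  isogenyIndex c.right / isogenyIndex c.left

end GroupCorrespondence

/-- A correspondence `L ← W → M` of abelian groups. -/
structure AbCorrespondence (L M : Type u) [AddCommGroup L] [AddCommGroup M] where
  W : Type u
  [addCommGroup : AddCommGroup W]
  left : W →+ L
  right : W →+ M

attribute [instance] AbCorrespondence.addCommGroup

namespace AbCorrespondence

variable {L M : Type u} [AddCommGroup L] [AddCommGroup M]

/-- A commensurability of abelian groups: both legs are isogenies. -/
def IsCommensurability (c : AbCorrespondence L M) : Prop :=
  IsAddIsogeny c.left ∧ IsAddIsogeny c.right

/-- The endomorphism ring of a correspondence `L ← W → M`: the triples `(lam, nu, mu)` in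
`End L × End W × End M` that are compatible with both legs. -/
def endRing (c : AbCorrespondence L M) :
    Subring (AddMonoid.End L × AddMonoid.End c.W × AddMonoid.End M) where
  carrier := {p | (∀ w : c.W, p.1 (c.left w) = c.left (p.2.1 w)) ∧
    ∀ w : c.W, p.2.2 (c.right w) = c.right (p.2.1 w)}
  mul_mem' := by
    rintro a b ⟨ha, ha'⟩ ⟨hb, hb'⟩
    exact ⟨fun w => by simp [hb, ha], fun w => by simp [hb', ha']⟩
  one_mem' := ⟨fun w => by simp, fun w => by simp⟩
  add_mem' := by
    rintro a b ⟨ha, ha'⟩ ⟨hb, hb'⟩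
    exact ⟨fun w => by
        change a.1 (c.left w) + b.1 (c.left w) = c.left (a.2.1 w + b.2.1 w)
        simp [hb, ha],
      fun w => by
        change a.2.2 (c.right w) + b.2.2 (c.right w) = c.right (a.2.1 w + b.2.1 w)
        simp [hb', ha']⟩
  zero_mem' := ⟨fun w => by simp, fun w => by simp⟩
  neg_mem' := by
    rintro a ⟨ha, ha'⟩
    exact ⟨fun w => by
        change -a.1 (c.left w) = c.left (-a.2.1 w)
        simp [ha],
      fun w => by
        change -a.2.2 (c.right w) = c.right (-a.2.1 w)
        simp [ha']⟩

/-- The group correspondence `Aut L ← Aut c → Aut M` attached to a correspondence `c`, where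
`Aut` denotes the group of units of the endomorphism ring. -/
def aut (c : AbCorrespondence L M) :
    GroupCorrespondence (AddMonoid.End L)ˣ (AddMonoid.End M)ˣ where
  W := (c.endRing)ˣ
  left := Units.map
    ((RingHom.fst (AddMonoid.End L) (AddMonoid.End c.W × AddMonoid.End M)).comp
      c.endRing.subtype : c.endRing →* AddMonoid.End L)
  right := Units.map
    (((RingHom.snd (AddMonoid.End c.W) (AddMonoid.End M)).comp
      (RingHom.snd (AddMonoid.End L) (AddMonoid.End c.W × AddMonoid.End M))).comp
      c.endRing.subtype : c.endRing →* AddMonoid.End M)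

end AbCorrespondence

open Classical in
/-- The index of automorphism groups: the index of `c.aut` for a commensurability `c` from `L`
to `M` (and `0` if there is none). That the value is independent of `c` is not part of the
definition. -/
noncomputable def ia (L M : Type u) [AddCommGroup L] [AddCommGroup M] : ℚ :=
  if h : ∃ c : AbCorrespondence L M, c.IsCommensurability then h.choose.aut.index else 0

end Commens

/-! A splitting `A ≅ ℤⁿ ⊕ A₀` makes `Aut A` act on the free part. The resulting map `Aut A → GLₙ(ℤ)`
is surjective, and its kernel is in bijection with `Hom(ℤⁿ, A₀) × Aut A₀`, hence of order `(#A₀)ⁿ ·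
#Aut A₀` (`card_ker_autFreeRep`).

A commensurability induces an isomorphism `L ⊗ ℚ ≅ M ⊗ ℚ`. By Smith normal form it becomes `D / k`
with `D` diagonal, once the splittings are adapted (`exists_diagonal`). Let `R` be the group of
pairs `(g, h)` in `GLₙ(ℤ)²` with `D g = h D`. Then `Aut c → R` is an isogeny `u`, and `R` embeds
with finite index in either factor. The two indices agree because `(g, h) ↦ (h⁻ᵀ, g⁻ᵀ)` preserves
`R`, as `D` is symmetric.

The index of isogenies is multiplicative (`isogenyIndex_comp`), so both legs of `Aut c` have index
`#ker · (GLₙ(ℤ) : R) · i(u)`, with `ker` the kernel above for `L` or `M`. The quotient is the ratio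
of the two kernel orders, whatever `c` is. -/

namespace Commens

/-! ### Multiplicativity of the isogeny index. -/

section IsogenyIndex

variable {G A B : Type*} [Group G] [Group A] [Group B]

theorem relIndex_sup_of_normal (H K : Subgroup A) [K.Normal] :
    H.relIndex (H ⊔ K) = H.relIndex K := by
  refine (Nat.card_congr (Equiv.ofBijective
    (Subgroup.quotientSubgroupOfEmbeddingOfLE H (le_sup_right : K ≤ H ⊔ K))
    ⟨Function.Embedding.injective _, ?_⟩)).symm
  intro q
  obtain ⟨⟨x, hx⟩, rfl⟩ := QuotientGroup.mk_surjective q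
  obtain ⟨k, hk, h, hh, rfl⟩ := Subgroup.mem_sup_of_normal_left.1 (sup_comm H K ▸ hx)
  refine ⟨QuotientGroup.mk ⟨k, hk⟩, ?_⟩
  rw [Subgroup.quotientSubgroupOfEmbeddingOfLE_apply_mk]
  refine QuotientGroup.eq.2 ?_
  simpa [Subgroup.mem_subgroupOf] using hh

theorem card_ker_comp (p : A →* B) (l : G →* A) :
    Nat.card (p.comp l).ker = Nat.card l.ker * Nat.card (l.range ⊓ p.ker : Subgroup A) := by
  have h1 : l.ker ≤ (p.comp l).ker := fun x hx => by
    simp only [MonoidHom.mem_ker, MonoidHom.comp_apply] at hx ⊢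
    rw [hx, map_one]
  have h2 : (p.comp l).ker.map l = l.range ⊓ p.ker := by
    rw [← MonoidHom.comap_ker, Subgroup.map_comap_eq]
  rw [← h2, ← Subgroup.relIndex_ker, ← Subgroup.relIndex_bot_left, ← Subgroup.relIndex_bot_left,
    Subgroup.relIndex_mul_relIndex _ _ _ bot_le h1]

theorem index_range_comp (p : A →* B) (l : G →* A) :
    (p.comp l).range.index = (l.range ⊔ p.ker).index * p.range.index := by
  rw [MonoidHom.range_comp, Subgroup.index_map]

theorem card_inf_ker_mul_relIndex (H : Subgroup A) (p : A →* B) :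
    Nat.card (H ⊓ p.ker : Subgroup A) * H.relIndex p.ker = Nat.card p.ker := by
  rw [← Subgroup.inf_relIndex_right, ← Subgroup.relIndex_bot_left,
    Subgroup.relIndex_mul_relIndex _ _ _ bot_le inf_le_right, Subgroup.relIndex_bot_left]

theorem relIndex_ker_mul_index (H : Subgroup A) (p : A →* B) :
    H.relIndex p.ker * (H ⊔ p.ker).index = H.index := by
  rw [← relIndex_sup_of_normal, Subgroup.relIndex_mul_index le_sup_left]

/-- The kernel grows by the factor `#(l.range ⊓ p.ker)`, and the index of `l.range` shrinks by
`l.range.relIndex p.ker` on passing to `l.range ⊔ p.ker`; these two numbers multiply to `#p.ker`. -/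
theorem isogenyIndex_comp {p : A →* B} (hp : IsIsogeny p) (l : G →* A) :
    isogenyIndex (p.comp l) = isogenyIndex p * isogenyIndex l := by
  have := hp.1
  have h1 := card_inf_ker_mul_relIndex l.range p
  have hx : Nat.card p.ker ≠ 0 := Nat.card_pos.ne'
  have h2 : l.range.relIndex p.ker ≠ 0 := fun h => hx (by rw [← h1, h, mul_zero])
  have h3 : Nat.card (l.range ⊓ p.ker : Subgroup A) ≠ 0 := fun h => hx (by rw [← h1, h, zero_mul])
  unfold isogenyIndex
  rw [card_ker_comp, index_range_comp, ← relIndex_ker_mul_index l.range p, ← h1]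
  have h2' : (l.range.relIndex p.ker : ℚ) ≠ 0 := by exact_mod_cast h2
  have h3' : (Nat.card (l.range ⊓ p.ker : Subgroup A) : ℚ) ≠ 0 := by exact_mod_cast h3
  push_cast
  -- An infinite `l.ker` has `Nat.card` equal to 0, and then both sides are 0 by division by zero.
  rcases eq_or_ne (Nat.card l.ker : ℚ) 0 with h | h
  · simp only [h, zero_mul, div_zero, mul_zero]
  · field_simp

theorem IsIsogeny.comp {p : A →* B} {l : G →* A} (hp : IsIsogeny p) (hl : IsIsogeny l) :
    IsIsogeny (p.comp l) := by
  have := hp.1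
  have := hl.1
  refine ⟨Nat.finite_of_card_ne_zero ?_, ⟨?_⟩⟩
  · rw [card_ker_comp]
    have : Finite (l.range ⊓ p.ker : Subgroup A) :=
      Finite.of_injective _ (Subgroup.inclusion_injective (inf_le_right : l.range ⊓ p.ker ≤ _))
    exact mul_ne_zero Nat.card_pos.ne' Nat.card_pos.ne'
  · rw [index_range_comp]
    exact mul_ne_zero (fun h => hl.2.index_ne_zero
      (by rw [← relIndex_ker_mul_index l.range p, h, mul_zero])) hp.2.index_ne_zero

theorem IsIsogeny.of_comp {p : A →* B} {l : G →* A} (hp : IsIsogeny p)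
    (h : IsIsogeny (p.comp l)) : IsIsogeny l := by
  have := hp.1
  have := h.1
  refine ⟨Nat.finite_of_card_ne_zero fun h0 => ?_, ⟨?_⟩⟩
  · have := card_ker_comp p l
    rw [h0, zero_mul] at this
    exact Nat.card_pos.ne' this
  · rw [← relIndex_ker_mul_index l.range p]
    refine mul_ne_zero (fun h0 => ?_) (fun h0 => h.2.index_ne_zero ?_)
    · have := card_inf_ker_mul_relIndex l.range p
      rw [h0, mul_zero] at this
      exact Nat.card_pos.ne' this.symm
    · rw [index_range_comp, h0, zero_mul]

theorem IsIsogeny.of_surjective {p : A →* B} (hp : Function.Surjective p) [Finite p.ker] :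
    IsIsogeny p := by
  refine ⟨inferInstance, ?_⟩
  rw [MonoidHom.range_eq_top.2 hp]
  infer_instance

theorem isogenyIndex_of_surjective {p : A →* B} (hp : Function.Surjective p) :
    isogenyIndex p = (Nat.card p.ker : ℚ)⁻¹ := by
  rw [isogenyIndex, MonoidHom.range_eq_top.2 hp]
  simp

theorem IsIsogeny.of_injective {p : A →* B} (hp : Function.Injective p)
    (h : p.range.FiniteIndex) : IsIsogeny p := by
  refine ⟨?_, h⟩
  rw [(MonoidHom.ker_eq_bot_iff p).2 hp]
  infer_instance

theorem isogenyIndex_of_injective {p : A →* B} (hp : Function.Injective p) :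
    isogenyIndex p = p.range.index := by
  rw [isogenyIndex, (MonoidHom.ker_eq_bot_iff p).2 hp]
  simp

/-- A commutative diagram `A ← G → A'` over `B ← R → B'` in which all vertical maps are isogenies
and `R` has the same index in `B` and in `B'`. -/
theorem index_of_surjective_of_injective {A' B' R : Type*} [Group A'] [Group B'] [Group R]
    {l : G →* A} {r : G →* A'} {p : A →* B} {q : A' →* B'} {u : G →* R} {s : R →* B} {t : R →* B'}
    (hp : Function.Surjective p) (hq : Function.Surjective q) [Finite p.ker] [Finite q.ker]
    (hs : Function.Injective s) (ht : Function.Injective t) (hsi : s.range.FiniteIndex)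
    (hst : s.range.index = t.range.index) (hu : IsIsogeny u)
    (hl : p.comp l = s.comp u) (hr : q.comp r = t.comp u) :
    IsIsogeny l ∧ IsIsogeny r ∧
      isogenyIndex r / isogenyIndex l = (Nat.card q.ker : ℚ) / Nat.card p.ker := by
  have hP := IsIsogeny.of_surjective hp
  have hQ := IsIsogeny.of_surjective hq
  have hS := IsIsogeny.of_injective hs hsi
  have hT := IsIsogeny.of_injective ht ⟨hst ▸ hsi.index_ne_zero⟩
  have h1 := isogenyIndex_comp hP l
  have h2 := isogenyIndex_comp hQ r
  rw [hl, isogenyIndex_comp hS, isogenyIndex_of_surjective hp, isogenyIndex_of_injective hs] at h1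
  rw [hr, isogenyIndex_comp hT, isogenyIndex_of_surjective hq, isogenyIndex_of_injective ht,
    ← hst] at h2
  refine ⟨hP.of_comp (hl ▸ hS.comp hu), hQ.of_comp (hr ▸ hT.comp hu), ?_⟩
  have hp0 : (Nat.card p.ker : ℚ) ≠ 0 := by exact_mod_cast Nat.card_pos.ne'
  have hq0 : (Nat.card q.ker : ℚ) ≠ 0 := by exact_mod_cast Nat.card_pos.ne'
  have hs0 : (s.range.index : ℚ) ≠ 0 := by exact_mod_cast hsi.index_ne_zero
  have hu0 : isogenyIndex u ≠ 0 := by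
    have := hu.1
    exact div_ne_zero (by exact_mod_cast hu.2.index_ne_zero) (by exact_mod_cast Nat.card_pos.ne')
  -- The bracketed factor is common to `l` and `r` and cancels in the quotient.
  have e1 : isogenyIndex l = Nat.card p.ker * (s.range.index * isogenyIndex u) := by
    rw [h1]; field_simp
  have e2 : isogenyIndex r = Nat.card q.ker * (s.range.index * isogenyIndex u) := by
    rw [h2]; field_simp
  rw [e1, e2]
  field_simp

end IsogenyIndex

/-! ### Pairs of integral matrices intertwined by a diagonal matrix. -/

section IntegralMatrices

variable {ι : Type*} [Fintype ι] [DecidableEq ι]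

/-- The principal congruence subgroup of level `m`. -/
def congruenceSubgroup (ι : Type*) [Fintype ι] [DecidableEq ι] (m : ℕ) :
    Subgroup (Matrix ι ι ℤ)ˣ :=
  (Units.map ((Int.castRingHom (ZMod m)).mapMatrix (m := ι)).toMonoidHom).ker

theorem finiteIndex_congruenceSubgroup (m : ℕ) [NeZero m] :
    (congruenceSubgroup ι m).FiniteIndex := by
  have : Finite (Matrix ι ι (ZMod m))ˣ := inferInstance
  unfold congruenceSubgroup
  infer_instance

theorem exists_of_mem_congruenceSubgroup {m : ℕ} {g : (Matrix ι ι ℤ)ˣ}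
    (hg : g ∈ congruenceSubgroup ι m) : ∃ x : Matrix ι ι ℤ, g.1 = 1 + (m : ℤ) • x := by
  have h : (g.1 - 1).map (Int.cast : ℤ → ZMod m) = 0 := by
    have h1 := congrArg Units.val (MonoidHom.mem_ker.1 hg)
    change g.1.map (Int.cast : ℤ → ZMod m) = 1 at h1
    rw [Matrix.map_sub _ (fun a b => Int.cast_sub a b), h1, Matrix.map_one _ (by simp) (by simp),
      sub_self]
  choose x hx using fun i j =>
    (ZMod.intCast_zmod_eq_zero_iff_dvd ((g.1 - 1) i j) m).1 (congrFun (congrFun h i) j)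
  refine ⟨Matrix.of x, ?_⟩
  rw [← sub_eq_iff_eq_add']
  ext i j
  simpa using hx i j

/-- Dividing by `m` puts invertibility in a form that carries over to any endomorphisms `1 + i x r`
with `r ∘ i = m`. -/
theorem add_add_smul_mul_eq_zero {m : ℤ} (hm : m ≠ 0) {x y : Matrix ι ι ℤ}
    (h : (1 + m • x) * (1 + m • y) = 1) : x + y + m • (x * y) = 0 := by
  have h1 : m • (x + y + m • (x * y)) = 0 := by
    rw [← sub_eq_zero.2 h]
    simp only [mul_add, add_mul, mul_one, one_mul, smul_add, smul_mul_smul_comm, smul_smul]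
    abel
  exact (smul_eq_zero.1 h1).resolve_left hm

/-- Pairs of invertible integral matrices intertwined by `D`. -/
def intertwiners (D : Matrix ι ι ℤ) : Subgroup ((Matrix ι ι ℤ)ˣ × (Matrix ι ι ℤ)ˣ) where
  carrier := {p | D * p.1 = p.2 * D}
  mul_mem' := by
    rintro ⟨a, b⟩ ⟨c, d⟩ (h : D * a = b * D) (h' : D * c = d * D)
    change D * (a * c : Matrix ι ι ℤ) = (b * d : Matrix ι ι ℤ) * D
    rw [← mul_assoc, h, mul_assoc, h', mul_assoc]
  one_mem' := by simp
  inv_mem' := by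
    rintro ⟨a, b⟩ (h : D * a = b * D)
    change D * (a⁻¹ : (Matrix ι ι ℤ)ˣ) = (b⁻¹ : (Matrix ι ι ℤ)ˣ) * D
    rw [Units.mul_inv_eq_iff_eq_mul, mul_assoc, h, Units.inv_mul_cancel_left]

theorem mem_intertwiners {D : Matrix ι ι ℤ} {p : (Matrix ι ι ℤ)ˣ × (Matrix ι ι ℤ)ˣ} :
    p ∈ intertwiners D ↔ D * p.1 = p.2 * D := Iff.rfl

def intertwinersFst (D : Matrix ι ι ℤ) : intertwiners D →* (Matrix ι ι ℤ)ˣ :=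
  (MonoidHom.fst _ _).comp (intertwiners D).subtype

def intertwinersSnd (D : Matrix ι ι ℤ) : intertwiners D →* (Matrix ι ι ℤ)ˣ :=
  (MonoidHom.snd _ _).comp (intertwiners D).subtype

theorem diagonal_mul_cancel {d : ι → ℤ} (hd : ∀ i, d i ≠ 0) {x y : Matrix ι ι ℤ}
    (h : Matrix.diagonal d * x = Matrix.diagonal d * y) : x = y := by
  ext i j
  have := congrFun (congrFun h i) j
  simpa [Matrix.diagonal_mul, hd i] using this

theorem mul_diagonal_cancel {d : ι → ℤ} (hd : ∀ i, d i ≠ 0) {x y : Matrix ι ι ℤ}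
    (h : x * Matrix.diagonal d = y * Matrix.diagonal d) : x = y := by
  ext i j
  have := congrFun (congrFun h i) j
  simpa [Matrix.mul_diagonal, hd j] using this

theorem intertwinersFst_injective {d : ι → ℤ} (hd : ∀ i, d i ≠ 0) :
    Function.Injective (intertwinersFst (Matrix.diagonal d)) := by
  rintro ⟨⟨a, b⟩, h⟩ ⟨⟨a', b'⟩, h'⟩ (e : a = a')
  subst e
  rw [mem_intertwiners] at h h'
  have : b = b' := Units.ext (mul_diagonal_cancel hd (h.symm.trans h'))
  subst this
  rfl

theorem intertwinersSnd_injective {d : ι → ℤ} (hd : ∀ i, d i ≠ 0) :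
    Function.Injective (intertwinersSnd (Matrix.diagonal d)) := by
  rintro ⟨⟨a, b⟩, h⟩ ⟨⟨a', b'⟩, h'⟩ (e : b = b')
  subst e
  rw [mem_intertwiners] at h h'
  have : a = a' := Units.ext (diagonal_mul_cancel hd (h.trans h'.symm))
  subst this
  rfl

/-- The contragredient automorphism `g ↦ (gᵀ)⁻¹`. -/
def contragredient (ι : Type*) [Fintype ι] [DecidableEq ι] :
    (Matrix ι ι ℤ)ˣ ≃* (Matrix ι ι ℤ)ˣ :=
  ((Units.mapEquiv (Matrix.transposeRingEquiv ι ℤ).toMulEquiv).trans Units.opEquiv).trans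
    (MulEquiv.inv' _).symm

theorem contragredient_apply (g : (Matrix ι ι ℤ)ˣ) :
    (contragredient ι g : Matrix ι ι ℤ) = (g⁻¹ : (Matrix ι ι ℤ)ˣ).1.transpose := rfl

theorem contragredient_contragredient (g : (Matrix ι ι ℤ)ˣ) :
    contragredient ι (contragredient ι g) = g := by
  ext1
  rw [contragredient_apply, ← map_inv, contragredient_apply, inv_inv, Matrix.transpose_transpose]

/-- A diagonal matrix is symmetric, so transposing the relation for the inverse pair interchanges
the two entries. -/
theorem swap_contragredient_mem_intertwiners {d : ι → ℤ} {a b : (Matrix ι ι ℤ)ˣ}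
    (h : (a, b) ∈ intertwiners (Matrix.diagonal d)) :
    (contragredient ι b, contragredient ι a) ∈ intertwiners (Matrix.diagonal d) := by
  have h1 : (a⁻¹, b⁻¹) ∈ intertwiners (Matrix.diagonal d) := inv_mem h
  rw [mem_intertwiners] at h1 ⊢
  have h2 := congrArg Matrix.transpose h1
  simp only [Matrix.transpose_mul, Matrix.diagonal_transpose] at h2
  simp only [contragredient_apply]
  exact h2.symm

theorem map_range_intertwinersFst (d : ι → ℤ) :
    (intertwinersFst (Matrix.diagonal d)).range.map (contragredient ι : _ →* (Matrix ι ι ℤ)ˣ) =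
      (intertwinersSnd (Matrix.diagonal d)).range := by
  ext g
  constructor
  · rintro ⟨_, ⟨⟨⟨a, b⟩, h⟩, rfl⟩, rfl⟩
    exact ⟨⟨_, swap_contragredient_mem_intertwiners h⟩, rfl⟩
  · rintro ⟨⟨⟨a, b⟩, h⟩, rfl⟩
    exact ⟨_, ⟨⟨_, swap_contragredient_mem_intertwiners h⟩, rfl⟩,
      contragredient_contragredient b⟩

theorem index_range_intertwiners (d : ι → ℤ) :
    (intertwinersFst (Matrix.diagonal d)).range.index =
      (intertwinersSnd (Matrix.diagonal d)).range.index := by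
  rw [← map_range_intertwinersFst, Subgroup.index_map_equiv]

/-- If `m` is a multiple of every `d i` and `g = 1 + m x`, then `D g D⁻¹ = 1 + D x D'` is integral,
where `D' = m D⁻¹`. So a principal congruence subgroup lies in the range. -/
theorem finiteIndex_range_intertwinersFst {d : ι → ℤ} (hd : ∀ i, d i ≠ 0) :
    (intertwinersFst (Matrix.diagonal d)).range.FiniteIndex := by
  set m : ℕ := (∏ i, d i).natAbs
  have hm : m ≠ 0 := Int.natAbs_ne_zero.2 (Finset.prod_ne_zero_iff.2 fun i _ => hd i)
  have : NeZero m := ⟨hm⟩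
  have hm' : (m : ℤ) ≠ 0 := by exact_mod_cast hm
  have hdvd : ∀ i, d i ∣ (m : ℤ) := fun i =>
    Int.dvd_natAbs.2 (Finset.dvd_prod_of_mem d (Finset.mem_univ i))
  choose d' hd' using hdvd
  have h2 : Matrix.diagonal d' * Matrix.diagonal d = (m : ℤ) • (1 : Matrix ι ι ℤ) := by
    rw [Matrix.diagonal_mul_diagonal, Matrix.smul_one_eq_diagonal]
    exact congrArg _ (funext fun i => by rw [mul_comm, ← hd' i])
  have := finiteIndex_congruenceSubgroup (ι := ι) m
  refine Subgroup.finiteIndex_of_le (H := congruenceSubgroup ι m) fun g hg => ?_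
  obtain ⟨x, hx⟩ := exists_of_mem_congruenceSubgroup hg
  obtain ⟨y, hy⟩ := exists_of_mem_congruenceSubgroup (inv_mem hg)
  have hxy := add_add_smul_mul_eq_zero hm' (hx ▸ hy ▸ g.mul_inv)
  have hyx := add_add_smul_mul_eq_zero hm' (hx ▸ hy ▸ g.inv_mul)
  have key : ∀ x y : Matrix ι ι ℤ, x + y + (m : ℤ) • (x * y) = 0 →
      (1 + Matrix.diagonal d * x * Matrix.diagonal d') *
        (1 + Matrix.diagonal d * y * Matrix.diagonal d') = 1 := by
    intro x y h
    calc _ = 1 + Matrix.diagonal d * (x + y + x * (Matrix.diagonal d' * Matrix.diagonal d) * y) *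
          Matrix.diagonal d' := by noncomm_ring
      _ = 1 := by rw [h2, mul_smul_comm, mul_one, smul_mul_assoc, h, mul_zero, zero_mul, add_zero]
  refine ⟨⟨(g, ⟨_, _, key x y hxy, key y x hyx⟩), ?_⟩, rfl⟩
  rw [mem_intertwiners]
  change _ * g.1 = (1 + _) * _
  rw [hx, add_mul, mul_assoc _ _ (Matrix.diagonal d), h2]
  rw [mul_add, mul_one, one_mul, mul_smul_comm, mul_smul_comm, mul_one]

end IntegralMatrices

/-! ### The action of `Aut A` on the free part, and its kernel. -/

section Splitting

variable {ι A A₀ : Type*} [AddCommGroup A] [AddCommGroup A₀]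

theorem end_ext {f g : AddMonoid.End A} (h : ∀ x, f x = g x) : f = g := DFunLike.ext _ _ h

theorem map_eq_zero_of_finite [Finite A₀] (φ : A₀ →+ (ι → ℤ)) (x : A₀) : φ x = 0 := by
  have h : Nat.card A₀ • φ x = 0 := by rw [← map_nsmul, card_nsmul_eq_zero', map_zero]
  exact (smul_eq_zero.1 h).resolve_left Nat.card_pos.ne'

/-- The free part of a splitting. -/
def freePart (e : A ≃+ (ι → ℤ) × A₀) : A →+ (ι → ℤ) := (AddMonoidHom.fst _ _).comp e.toAddMonoidHom

/-- The inclusion of the free part of a splitting. -/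
def freeIncl (e : A ≃+ (ι → ℤ) × A₀) : (ι → ℤ) →+ A :=
  e.symm.toAddMonoidHom.comp (AddMonoidHom.inl _ _)

theorem freePart_apply (e : A ≃+ (ι → ℤ) × A₀) (x : A) : freePart e x = (e x).1 := rfl

theorem apply_freeIncl (e : A ≃+ (ι → ℤ) × A₀) (v : ι → ℤ) : e (freeIncl e v) = (v, 0) :=
  e.apply_symm_apply _

theorem freePart_freeIncl (e : A ≃+ (ι → ℤ) × A₀) (v : ι → ℤ) : freePart e (freeIncl e v) = v := by
  rw [freePart_apply, apply_freeIncl]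

theorem eq_freeIncl_add (e : A ≃+ (ι → ℤ) × A₀) (x : A) :
    x = freeIncl e (freePart e x) + e.symm (0, (e x).2) := by
  apply e.injective
  rw [map_add, apply_freeIncl, e.apply_symm_apply, freePart_apply]
  simp

variable [Fintype ι]

/-- The automorphism with matrix `g` on the free part, twisted by `b` and `d`. -/
noncomputable def blockEnd (e : A ≃+ (ι → ℤ) × A₀) (g : Matrix ι ι ℤ) (b : (ι → ℤ) →+ A₀)
    (d : A₀ →+ A₀) : AddMonoid.End A :=
  e.symm.toAddMonoidHom.comp
    (((g.mulVecLin.toAddMonoidHom.comp (freePart e))).prod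
      (b.comp (freePart e) + d.comp ((AddMonoidHom.snd _ _).comp e.toAddMonoidHom)))

theorem apply_blockEnd (e : A ≃+ (ι → ℤ) × A₀) (g : Matrix ι ι ℤ) (b : (ι → ℤ) →+ A₀)
    (d : A₀ →+ A₀) (x : A) :
    e (blockEnd e g b d x) = (g.mulVec (e x).1, b (e x).1 + d (e x).2) :=
  e.apply_symm_apply _

theorem blockEnd_mul (e : A ≃+ (ι → ℤ) × A₀) (g g' : Matrix ι ι ℤ) (b b' : (ι → ℤ) →+ A₀)
    (d d' : A₀ →+ A₀) :
    blockEnd e g b d * blockEnd e g' b' d' =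
      blockEnd e (g * g') (b.comp g'.mulVecLin.toAddMonoidHom + d.comp b') (d.comp d') := by
  refine end_ext fun x => e.injective ?_
  rw [AddMonoid.End.coe_mul, Function.comp_apply]
  simp only [apply_blockEnd, Matrix.mulVec_mulVec]
  simp [add_assoc]

variable [DecidableEq ι]

theorem eq_of_mulVec_eq {x y : Matrix ι ι ℤ} (h : ∀ v, x.mulVec v = y.mulVec v) : x = y :=
  Matrix.toLin'.injective (LinearMap.ext h)

/-- The matrix describing the action of an endomorphism on the free part. -/
noncomputable def freeMatrix (e : A ≃+ (ι → ℤ) × A₀) (lam : AddMonoid.End A) : Matrix ι ι ℤ :=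
  LinearMap.toMatrix' ((freePart e).comp ((lam : A →+ A).comp (freeIncl e))).toIntLinearMap

theorem freeMatrix_mulVec (e : A ≃+ (ι → ℤ) × A₀) (lam : AddMonoid.End A) (v : ι → ℤ) :
    (freeMatrix e lam).mulVec v = freePart e (lam (freeIncl e v)) := by
  rw [freeMatrix, LinearMap.toMatrix'_mulVec]
  rfl

theorem blockEnd_one (e : A ≃+ (ι → ℤ) × A₀) :
    blockEnd e 1 0 (AddMonoidHom.id A₀) = 1 := by
  refine end_ext fun x => e.injective ?_
  rw [apply_blockEnd]
  simp

/-- The kernel element of `autFreeRep` with given lower blocks. -/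
noncomputable def blockUnit (e : A ≃+ (ι → ℤ) × A₀) (b : (ι → ℤ) →+ A₀) (d : AddAut A₀) :
    (AddMonoid.End A)ˣ where
  val := blockEnd e 1 b d.toAddMonoidHom
  inv := blockEnd e 1 (-(d.symm.toAddMonoidHom.comp b)) d.symm.toAddMonoidHom
  val_inv := by
    rw [blockEnd_mul, ← blockEnd_one e, mul_one]
    congr 1 <;> ext <;> simp
  inv_val := by
    rw [blockEnd_mul, ← blockEnd_one e, mul_one]
    congr 1 <;> ext <;> simp

theorem apply_blockUnit (e : A ≃+ (ι → ℤ) × A₀) (b : (ι → ℤ) →+ A₀) (d : AddAut A₀) (x : A) :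
    e ((blockUnit e b d).1 x) = ((e x).1, b (e x).1 + d (e x).2) :=
  (apply_blockEnd e 1 b d.toAddMonoidHom x).trans (by rw [Matrix.one_mulVec]; rfl)

theorem blockUnit_injective (e : A ≃+ (ι → ℤ) × A₀) {b b' : (ι → ℤ) →+ A₀} {d d' : AddAut A₀}
    (h : blockUnit e b d = blockUnit e b' d') : b = b' ∧ d = d' := by
  have h1 : ∀ v y, b v + d y = b' v + d' y := fun v y => by
    have := congrArg (fun lam : (AddMonoid.End A)ˣ => (e (lam.1 (e.symm (v, y)))).2) h
    simpa [apply_blockUnit] using this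
  exact ⟨AddMonoidHom.ext fun v => by simpa using h1 v 0, AddEquiv.ext fun y => by simpa using h1 0 y⟩

variable [Finite A₀]

/-- The torsion summand `A₀` has only the zero map to `ℤ^ι`, so the free part of `lam x` depends on
that of `x` alone. -/
theorem freePart_apply_end (e : A ≃+ (ι → ℤ) × A₀) (lam : AddMonoid.End A) (x : A) :
    freePart e (lam x) = (freeMatrix e lam).mulVec (freePart e x) := by
  conv_lhs => rw [eq_freeIncl_add e x]
  rw [map_add, map_add, ← freeMatrix_mulVec]
  have := map_eq_zero_of_finite (((freePart e).comp (lam : A →+ A)).comp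
    (e.symm.toAddMonoidHom.comp (AddMonoidHom.inr _ _))) (e x).2
  exact add_eq_left.2 this

/-- The action of endomorphisms on the free part. -/
noncomputable def freeRep (e : A ≃+ (ι → ℤ) × A₀) : AddMonoid.End A →* Matrix ι ι ℤ where
  toFun := freeMatrix e
  map_one' := eq_of_mulVec_eq fun v => by
    rw [freeMatrix_mulVec, AddMonoid.End.coe_one, id, freePart_freeIncl, Matrix.one_mulVec]
  map_mul' lam mu := eq_of_mulVec_eq fun v => by
    rw [freeMatrix_mulVec, AddMonoid.End.coe_mul, Function.comp_apply, freePart_apply_end,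
      ← freeMatrix_mulVec, Matrix.mulVec_mulVec]

noncomputable def autFreeRep (e : A ≃+ (ι → ℤ) × A₀) :
    (AddMonoid.End A)ˣ →* (Matrix ι ι ℤ)ˣ := Units.map (freeRep e)

theorem autFreeRep_val (e : A ≃+ (ι → ℤ) × A₀) (lam : (AddMonoid.End A)ˣ) :
    (autFreeRep e lam).1 = freeMatrix e lam.1 := rfl

theorem freeMatrix_eq_iff (e : A ≃+ (ι → ℤ) × A₀) (lam : AddMonoid.End A) (g : Matrix ι ι ℤ) :
    freeMatrix e lam = g ↔ ∀ x, freePart e (lam x) = g.mulVec (freePart e x) := by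
  refine ⟨fun h x => h ▸ freePart_apply_end e lam x, fun h => eq_of_mulVec_eq fun v => ?_⟩
  rw [freeMatrix_mulVec, h, freePart_freeIncl]

theorem autFreeRep_surjective (e : A ≃+ (ι → ℤ) × A₀) : Function.Surjective (autFreeRep e) := by
  intro g
  refine ⟨⟨blockEnd e g.1 0 (AddMonoidHom.id A₀), blockEnd e g⁻¹.1 0 (AddMonoidHom.id A₀),
    ?_, ?_⟩, Units.ext ?_⟩
  · rw [blockEnd_mul, g.mul_inv]
    exact (congrArg (blockEnd e 1 · _) (by ext; simp)).trans (blockEnd_one e)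
  · rw [blockEnd_mul, g.inv_mul]
    exact (congrArg (blockEnd e 1 · _) (by ext; simp)).trans (blockEnd_one e)
  · rw [autFreeRep_val, freeMatrix_eq_iff]
    intro x
    rw [freePart_apply, apply_blockEnd, freePart_apply]

theorem blockUnit_mem_ker (e : A ≃+ (ι → ℤ) × A₀) (b : (ι → ℤ) →+ A₀) (d : AddAut A₀) :
    blockUnit e b d ∈ (autFreeRep e).ker := by
  rw [MonoidHom.mem_ker]
  refine Units.ext ?_
  rw [autFreeRep_val, freeMatrix_eq_iff]
  intro x
  rw [freePart_apply, apply_blockUnit, Units.val_one, Matrix.one_mulVec, freePart_apply]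

theorem freePart_of_mem_ker {e : A ≃+ (ι → ℤ) × A₀} {lam : (AddMonoid.End A)ˣ}
    (h : lam ∈ (autFreeRep e).ker) (x : A) : (e (lam.1 x)).1 = (e x).1 := by
  have h1 := congrArg Units.val (MonoidHom.mem_ker.1 h)
  rw [autFreeRep_val, freeMatrix_eq_iff, Units.val_one] at h1
  simpa [freePart_apply] using h1 x

theorem end_injective (lam : (AddMonoid.End A)ˣ) : Function.Injective lam.1 := by
  intro x y h
  have h1 : ∀ z, lam⁻¹.1 (lam.1 z) = z := fun z => DFunLike.congr_fun lam.inv_mul z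
  rw [← h1 x, h, h1 y]

theorem exists_blockUnit {e : A ≃+ (ι → ℤ) × A₀} {lam : (AddMonoid.End A)ˣ}
    (h : lam ∈ (autFreeRep e).ker) : ∃ b d, blockUnit e b d = lam := by
  let q : A →+ A₀ := ((AddMonoidHom.snd _ _).comp e.toAddMonoidHom).comp (lam.1 : A →+ A)
  let j : A₀ →+ A := e.symm.toAddMonoidHom.comp (AddMonoidHom.inr _ _)
  have hj : ∀ y, e (j y) = (0, y) := fun y => e.apply_symm_apply _
  -- `lam` preserves the free coordinate, hence maps `A₀` injectively into itself; finiteness makes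
  -- this an automorphism.
  have hinj : Function.Injective (q.comp j) := by
    rw [injective_iff_map_eq_zero]
    intro y hy
    have h1 : lam.1 (j y) = lam.1 0 := by
      apply e.injective
      rw [map_zero, map_zero]
      refine Prod.ext ?_ hy
      rw [freePart_of_mem_ker h, hj]
      rfl
    have h2 := congrArg e (end_injective lam h1)
    rw [hj, map_zero] at h2
    exact congrArg Prod.snd h2
  refine ⟨q.comp (freeIncl e), AddEquiv.ofBijective (q.comp j) (Finite.injective_iff_bijective.1 hinj),
    Units.ext (end_ext fun x => e.injective ?_)⟩
  rw [apply_blockUnit]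
  refine Prod.ext (freePart_of_mem_ker h x).symm ?_
  conv_rhs => rw [eq_freeIncl_add e x, map_add, map_add]
  rfl

noncomputable def kerAutFreeRepEquiv (e : A ≃+ (ι → ℤ) × A₀) :
    ((ι → ℤ) →+ A₀) × AddAut A₀ ≃ (autFreeRep e).ker :=
  Equiv.ofBijective (fun p => ⟨blockUnit e p.1 p.2, blockUnit_mem_ker e p.1 p.2⟩)
    ⟨fun _ _ h => Prod.ext_iff.2 (blockUnit_injective e (congrArg Subtype.val h)),
      fun ⟨_, h⟩ => let ⟨b, d, hbd⟩ := exists_blockUnit h; ⟨(b, d), Subtype.ext hbd⟩⟩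

noncomputable def homPiIntEquiv (ι : Type*) [Fintype ι] [DecidableEq ι] (A : Type*)
    [AddCommGroup A] : ((ι → ℤ) →+ A) ≃ (ι → A) :=
  (addMonoidHomLequivInt ℤ).toEquiv.trans ((Pi.basisFun ℤ ι).constr ℤ).symm.toEquiv

instance finite_ker_autFreeRep (e : A ≃+ (ι → ℤ) × A₀) : Finite (autFreeRep e).ker := by
  have : Finite ((ι → ℤ) →+ A₀) := Finite.of_equiv _ (homPiIntEquiv ι A₀).symm
  have : Finite (AddAut A₀) := Finite.of_injective (fun d : AddAut A₀ => (d : A₀ → A₀))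
    DFunLike.coe_injective
  exact Finite.of_equiv _ (kerAutFreeRepEquiv e)

theorem card_ker_autFreeRep (e : A ≃+ (ι → ℤ) × A₀) :
    Nat.card (autFreeRep e).ker = Nat.card A₀ ^ Fintype.card ι * Nat.card (AddAut A₀) := by
  rw [← Nat.card_congr (kerAutFreeRepEquiv e), Nat.card_prod, Nat.card_congr (homPiIntEquiv ι A₀),
    Nat.card_fun, Nat.card_eq_fintype_card (α := ι)]

end Splitting

/-! ### Automorphisms of the form `1 + i x r`. -/

section Retraction

variable {ι A : Type*} [Fintype ι] [AddCommGroup A]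

/-- The endomorphism `1 + i ∘ x ∘ r`. -/
noncomputable def onePlus (i : (ι → ℤ) →+ A) (r : A →+ (ι → ℤ)) (x : Matrix ι ι ℤ) :
    AddMonoid.End A :=
  AddMonoidHom.id A + i.comp (x.mulVecLin.toAddMonoidHom.comp r)

theorem onePlus_apply (i : (ι → ℤ) →+ A) (r : A →+ (ι → ℤ)) (x : Matrix ι ι ℤ) (w : A) :
    onePlus i r x w = w + i (x.mulVec (r w)) := rfl

/-- From `r ∘ i = m` the product expands to `1 + i (x + y + m x y) r`. -/
theorem onePlus_mul_eq_one [DecidableEq ι] {i : (ι → ℤ) →+ A} {r : A →+ (ι → ℤ)} {m : ℤ}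
    (h : ∀ v, r (i v) = m • v) {x y : Matrix ι ι ℤ} (hxy : x + y + m • (x * y) = 0) :
    onePlus i r x * onePlus i r y = 1 := by
  refine end_ext fun w => ?_
  rw [AddMonoid.End.coe_mul, Function.comp_apply, onePlus_apply, onePlus_apply,
    AddMonoid.End.coe_one, id, map_add, h, add_assoc, ← map_add, Matrix.mulVec_add,
    Matrix.mulVec_smul, Matrix.mulVec_mulVec]
  have h1 := congrArg (fun z : Matrix ι ι ℤ => z.mulVec (r w)) hxy
  simp only [Matrix.add_mulVec, Matrix.smul_mulVec, Matrix.zero_mulVec] at h1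
  rw [add_eq_left, ← map_zero i, ← h1]
  congr 1
  abel

end Retraction

/-! ### Finiteness properties and quasi-inverses of isogenies. -/

section FiniteIndex

variable {A B : Type*} [AddCommGroup A] [AddCommGroup B]

theorem finite_preimage_of_finite_ker (f : A →+ B) [Finite f.ker] {s : Set B} (hs : s.Finite) :
    (f ⁻¹' s).Finite := by
  refine hs.preimage' fun b _ => ?_
  rcases (f ⁻¹' {b}).eq_empty_or_nonempty with h | ⟨a, ha⟩
  · rw [h]; exact Set.finite_empty
  · have : ((f.ker : Set A)).Finite := Set.toFinite _
    refine (this.image (a + ·)).subset fun x hx => ⟨x - a, ?_, by simp⟩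
    rw [Set.mem_preimage, Set.mem_singleton_iff] at hx ha
    simp [AddMonoidHom.mem_ker, hx, ha]

theorem finite_ker_comp (g : B →+ A) {C : Type*} [AddCommGroup C] (f : A →+ C)
    [Finite g.ker] [Finite f.ker] : Finite (f.comp g).ker :=
  (finite_preimage_of_finite_ker g (Set.toFinite (f.ker : Set A))).to_subtype

theorem moduleFinite_of_finite_ker [AddGroup.FG B] (f : A →+ B) [Finite f.ker] :
    Module.Finite ℤ A := by
  have : Module.Finite ℤ B := Module.Finite.iff_addGroup_fg.2 inferInstance
  have hk : Finite (LinearMap.ker f.toIntLinearMap) := inferInstanceAs (Finite f.ker)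
  refine ⟨Submodule.fg_of_fg_map_of_fg_inf_ker f.toIntLinearMap (IsNoetherian.noetherian _) ?_⟩
  rw [top_inf_eq]
  exact Module.Finite.iff_fg.1 inferInstance

theorem exists_lift_smul {ι : Type*} [Fintype ι] [DecidableEq ι] {f : A →+ B}
    (hf : f.range.FiniteIndex) (i : (ι → ℤ) →+ B) :
    ∃ (m : ℕ) (t : (ι → ℤ) →+ A), m ≠ 0 ∧ ∀ v, f (t v) = (m : ℤ) • i v := by
  -- The index of the range annihilates the cokernel, so these multiples of the basis images lift.
  have h : ∀ j, ∃ a, f a = f.range.index • i (Pi.single j 1) := fun j =>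
    f.range.nsmul_index_mem _
  choose a ha using h
  refine ⟨f.range.index, ((Pi.basisFun ℤ ι).constr ℤ a).toAddMonoidHom, hf.index_ne_zero, ?_⟩
  have : f.toIntLinearMap ∘ₗ (Pi.basisFun ℤ ι).constr ℤ a =
      (f.range.index : ℤ) • i.toIntLinearMap := by
    refine (Pi.basisFun ℤ ι).ext fun j => ?_
    simp [ha]
  exact fun v => LinearMap.congr_fun this v

theorem finite_ker_freePart {ι A₀ : Type*} [AddCommGroup A₀] [Finite A₀] (e : A ≃+ (ι → ℤ) × A₀) : Finite (freePart e).ker := by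
  refine Finite.of_injective (fun x : (freePart e).ker => (e x.1).2) fun x y h => ?_
  refine Subtype.ext (e.injective (Prod.ext ?_ h))
  exact x.2.trans y.2.symm

end FiniteIndex

/-! ### The isogeny from `Aut c` to the intertwining pairs. -/

section AutIndex

variable {ι : Type*} [Fintype ι] [DecidableEq ι] {L M : Type u} [AddCommGroup L] [AddCommGroup M]
  {L₀ M₀ : Type*} [AddCommGroup L₀] [AddCommGroup M₀]

variable (c : AbCorrespondence L M)

def endFst : (c.endRing)ˣ →* (AddMonoid.End L)ˣ := c.aut.left

def endSnd : (c.endRing)ˣ →* (AddMonoid.End M)ˣ := c.aut.right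

variable {c}

theorem endFst_left (x : (c.endRing)ˣ) (w : c.W) :
    (endFst c x).1 (c.left w) = c.left (x.1.1.2.1 w) := x.1.2.1 w

theorem endSnd_right (x : (c.endRing)ˣ) (w : c.W) :
    (endSnd c x).1 (c.right w) = c.right (x.1.1.2.1 w) := x.1.2.2 w

variable [Finite L₀] [Finite M₀] (eL : L ≃+ (ι → ℤ) × L₀) (eM : M ≃+ (ι → ℤ) × M₀)

/-- It suffices to compare both sides on multiples `m • v` that come from `c.W`, where compatibility
with the two legs applies. -/
theorem mem_intertwiners_of_aut (hc : c.IsCommensurability) {D : Matrix ι ι ℤ} {k : ℤ}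
    (hD : ∀ w, D.mulVec (freePart eL (c.left w)) = k • freePart eM (c.right w))
    (x : (c.endRing)ˣ) :
    (autFreeRep eL (endFst c x), autFreeRep eM (endSnd c x)) ∈ intertwiners D := by
  obtain ⟨m, t, hm, ht⟩ := exists_lift_smul hc.1.2 (freeIncl eL)
  rw [mem_intertwiners]
  refine eq_of_mulVec_eq fun v => ?_
  have hm' : (m : ℤ) ≠ 0 := by exact_mod_cast hm
  refine smul_right_injective _ hm' ?_
  have hv : (m : ℤ) • v = freePart eL (c.left (t v)) := by
    rw [ht, map_zsmul, freePart_freeIncl]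
  dsimp only
  rw [← Matrix.mulVec_smul, ← Matrix.mulVec_smul, hv, ← Matrix.mulVec_mulVec,
    ← Matrix.mulVec_mulVec, hD, Matrix.mulVec_smul, autFreeRep_val, autFreeRep_val,
    ← freePart_apply_end, ← freePart_apply_end, endFst_left, endSnd_right, hD]

/-- The action of `Aut c` on the free parts of both sides. -/
noncomputable def autToIntertwiners (hc : c.IsCommensurability) {D : Matrix ι ι ℤ} {k : ℤ}
    (hD : ∀ w, D.mulVec (freePart eL (c.left w)) = k • freePart eM (c.right w)) :
    (c.endRing)ˣ →* intertwiners D :=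
  (((autFreeRep eL).comp (endFst c)).prod ((autFreeRep eM).comp (endSnd c))).codRestrict
    (intertwiners D) (mem_intertwiners_of_aut eL eM hc hD)

/-- For a triple in the kernel, the outer entries lie in the finite kernels of `autFreeRep`. The
middle entry differs from the identity by values in a finite subgroup of `c.W`, and is determined on
finitely many generators. -/
theorem finite_ker_autToIntertwiners [AddGroup.FG L] (hc : c.IsCommensurability)
    {D : Matrix ι ι ℤ} {k : ℤ}
    (hD : ∀ w, D.mulVec (freePart eL (c.left w)) = k • freePart eM (c.right w)) :
    Finite (autToIntertwiners eL eM hc hD).ker := by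
  have := hc.1.1
  have := finite_ker_freePart eL
  have := finite_ker_comp c.left (freePart eL)
  have := moduleFinite_of_finite_ker c.left
  obtain ⟨S, hS⟩ := AddGroup.fg_def.1 (Module.Finite.iff_addGroup_fg.1 this)
  have h1 : ∀ x : (autToIntertwiners eL eM hc hD).ker, endFst c x.1 ∈ (autFreeRep eL).ker :=
    fun x => congrArg (fun p : intertwiners D => p.1.1) (MonoidHom.mem_ker.1 x.2)
  have h2 : ∀ x : (autToIntertwiners eL eM hc hD).ker, endSnd c x.1 ∈ (autFreeRep eM).ker :=
    fun x => congrArg (fun p : intertwiners D => p.1.2) (MonoidHom.mem_ker.1 x.2)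
  have h3 : ∀ (x : (autToIntertwiners eL eM hc hD).ker) (w : c.W),
      x.1.1.1.2.1 w - w ∈ ((freePart eL).comp c.left).ker := fun x w => by
    have h4 := freePart_of_mem_ker (h1 x) (c.left w)
    rw [endFst_left] at h4
    rw [AddMonoidHom.mem_ker, map_sub, sub_eq_zero]
    exact h4
  refine Finite.of_injective (fun x => ((⟨_, h1 x⟩ : (autFreeRep eL).ker),
    (⟨_, h2 x⟩ : (autFreeRep eM).ker), fun w : S => (⟨_, h3 x w⟩ :
      ((freePart eL).comp c.left).ker))) fun x y h => ?_
  simp only [Prod.mk.injEq, Subtype.mk.injEq, funext_iff] at h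
  obtain ⟨ha, hb, hw⟩ := h
  refine Subtype.ext (Units.ext (Subtype.ext (Prod.ext (congrArg Units.val ha)
    (Prod.ext ?_ (congrArg Units.val hb)))))
  refine AddMonoidHom.eq_of_eqOn_dense (f := (x.1.1.1.2.1 : c.W →+ c.W)) hS fun w hw' => ?_
  exact sub_left_injective (hw ⟨w, hw'⟩)

theorem finiteIndex_range_autToIntertwiners (hc : c.IsCommensurability)
    {d : ι → ℤ} {k : ℤ} (hk : k ≠ 0)
    (hD : ∀ w, (Matrix.diagonal d).mulVec (freePart eL (c.left w)) =
      k • freePart eM (c.right w)) :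
    (autToIntertwiners eL eM hc hD).range.FiniteIndex := by
  obtain ⟨m', t, hm', ht⟩ := exists_lift_smul hc.1.2 (freeIncl eL)
  -- The composite `c.right ∘ t` may have a component in `M₀`; multiplying by `N` kills it.
  set N := Nat.card M₀
  have hN : N ≠ 0 := Nat.card_pos.ne'
  set m := N * m' with hm
  have : NeZero m := ⟨mul_ne_zero hN hm'⟩
  have hmZ : (m : ℤ) ≠ 0 := by exact_mod_cast this.out
  have := finiteIndex_congruenceSubgroup (ι := ι) m
  refine Subgroup.finiteIndex_of_le
    (H := ((congruenceSubgroup ι m).prod (congruenceSubgroup ι m)).subgroupOf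
      (intertwiners (Matrix.diagonal d))) ?_
  rintro ⟨⟨g, h⟩, hgh⟩ ⟨hg : g ∈ congruenceSubgroup ι m, hh : h ∈ congruenceSubgroup ι m⟩
  have hgh' := inv_mem hgh
  rw [mem_intertwiners] at hgh hgh'
  change _ * (g⁻¹ : (Matrix ι ι ℤ)ˣ).1 = (h⁻¹ : (Matrix ι ι ℤ)ˣ).1 * _ at hgh'
  dsimp only at hgh
  obtain ⟨x, hx⟩ := exists_of_mem_congruenceSubgroup hg
  obtain ⟨x', hx'⟩ := exists_of_mem_congruenceSubgroup (inv_mem hg)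
  obtain ⟨y, hy⟩ := exists_of_mem_congruenceSubgroup hh
  obtain ⟨y', hy'⟩ := exists_of_mem_congruenceSubgroup (inv_mem hh)
  have cancel : ∀ x y : Matrix ι ι ℤ, Matrix.diagonal d * (1 + (m : ℤ) • x) =
      (1 + (m : ℤ) • y) * Matrix.diagonal d → Matrix.diagonal d * x = y * Matrix.diagonal d := by
    intro x y h
    rw [mul_add, add_mul, mul_one, one_mul, add_right_inj, mul_smul_comm, smul_mul_assoc] at h
    exact smul_right_injective _ hmZ h
  rw [hx, hy] at hgh
  rw [hx', hy'] at hgh'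
  have hxx := add_add_smul_mul_eq_zero hmZ (hx ▸ hx' ▸ g.mul_inv)
  have hxx' := add_add_smul_mul_eq_zero hmZ (hx ▸ hx' ▸ g.inv_mul)
  have hyy := add_add_smul_mul_eq_zero hmZ (hy ▸ hy' ▸ h.mul_inv)
  have hyy' := add_add_smul_mul_eq_zero hmZ (hy ▸ hy' ▸ h.inv_mul)
  let a : c.W →+ (ι → ℤ) := (freePart eL).comp c.left
  have hat : ∀ v, a (t v) = (m' : ℤ) • v := fun v => by
    change freePart eL (c.left (t v)) = _
    rw [ht, map_zsmul, freePart_freeIncl]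
  -- Explicit lift of the pair `(1 + m x, 1 + m y)`. All three entries have the form `1 + i x r`
  -- with `r ∘ i = m`, so one matrix identity inverts each of them.
  let T : Matrix ι ι ℤ → Matrix ι ι ℤ →
      AddMonoid.End L × AddMonoid.End c.W × AddMonoid.End M := fun x y =>
    (onePlus ((m : ℤ) • freeIncl eL) (freePart eL) x, onePlus ((N : ℤ) • t) a x,
      onePlus ((m : ℤ) • freeIncl eM) (freePart eM) y)
  have hT : ∀ x y : Matrix ι ι ℤ, Matrix.diagonal d * x = y * Matrix.diagonal d →
      T x y ∈ c.endRing := by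
    intro x y hxy
    refine ⟨fun w => ?_, fun w => ?_⟩
    · change onePlus _ _ _ _ = c.left (onePlus _ _ _ _)
      rw [onePlus_apply, onePlus_apply, map_add]
      congr 1
      change (m : ℤ) • freeIncl eL _ = c.left ((N : ℤ) • t _)
      rw [map_zsmul, ht, smul_smul, hm]
      push_cast
      rfl
    · change onePlus _ _ _ _ = c.right (onePlus _ _ _ _)
      rw [onePlus_apply, onePlus_apply, map_add]
      congr 1
      change (m : ℤ) • freeIncl eM _ = c.right ((N : ℤ) • t _)
      rw [map_zsmul]
      apply eM.injective
      rw [map_zsmul, map_zsmul, apply_freeIncl]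
      refine Prod.ext ?_ ?_
      · change (m : ℤ) • _ = (N : ℤ) • freePart eM (c.right _)
        refine smul_right_injective _ hk ?_
        dsimp only
        rw [smul_comm k (N : ℤ), ← hD]
        change _ = (N : ℤ) • (Matrix.diagonal d).mulVec (a (t _))
        rw [hat, Matrix.mulVec_smul, Matrix.mulVec_mulVec, hxy, ← Matrix.mulVec_mulVec,
          show a w = freePart eL (c.left w) from rfl, hD, Matrix.mulVec_smul, smul_smul, smul_smul,
          smul_smul, hm]
        push_cast
        ring_nf
      · change (m : ℤ) • (0 : M₀) = (N : ℤ) • _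
        rw [smul_zero, natCast_zsmul, card_nsmul_eq_zero']
  have hL : ∀ v, freePart eL (((m : ℤ) • freeIncl eL) v) = (m : ℤ) • v := fun v => by
    rw [AddMonoidHom.smul_apply, map_zsmul, freePart_freeIncl]
  have hM : ∀ v, freePart eM (((m : ℤ) • freeIncl eM) v) = (m : ℤ) • v := fun v => by
    rw [AddMonoidHom.smul_apply, map_zsmul, freePart_freeIncl]
  have hW : ∀ v, a (((N : ℤ) • t) v) = (m : ℤ) • v := fun v => by
    rw [AddMonoidHom.smul_apply, map_zsmul, hat, smul_smul, hm]
    push_cast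
    rfl
  have hmul : ∀ x y x' y' : Matrix ι ι ℤ, x + x' + (m : ℤ) • (x * x') = 0 →
      y + y' + (m : ℤ) • (y * y') = 0 → T x y * T x' y' = 1 := fun x y x' y' h h' =>
    Prod.ext (onePlus_mul_eq_one hL h)
      (Prod.ext (onePlus_mul_eq_one hW h) (onePlus_mul_eq_one hM h'))
  refine ⟨⟨⟨T x y, hT _ _ (cancel _ _ hgh)⟩, ⟨T x' y', hT _ _ (cancel _ _ hgh')⟩,
    Subtype.ext (hmul _ _ _ _ hxx hyy), Subtype.ext (hmul _ _ _ _ hxx' hyy')⟩, ?_⟩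
  refine Subtype.ext (Prod.ext (Units.ext ?_) (Units.ext ?_))
  · change freeMatrix eL (onePlus _ _ _) = g.1
    rw [freeMatrix_eq_iff]
    intro w
    rw [onePlus_apply, map_add, hL, hx, Matrix.add_mulVec, Matrix.one_mulVec, Matrix.smul_mulVec]
  · change freeMatrix eM (onePlus _ _ _) = h.1
    rw [freeMatrix_eq_iff]
    intro w
    rw [onePlus_apply, map_add, hM, hy, Matrix.add_mulVec, Matrix.one_mulVec, Matrix.smul_mulVec]

theorem aut_index_of_diagonal [AddGroup.FG L] (hc : c.IsCommensurability)
    {d : ι → ℤ} (hd : ∀ i, d i ≠ 0) {k : ℤ} (hk : k ≠ 0)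
    (hD : ∀ w, (Matrix.diagonal d).mulVec (freePart eL (c.left w)) =
      k • freePart eM (c.right w)) :
    c.aut.IsCommensurability ∧ c.aut.index =
      ((Nat.card M₀ : ℚ) ^ Fintype.card ι * (Nat.card (AddAut M₀) : ℚ)) /
        ((Nat.card L₀ : ℚ) ^ Fintype.card ι * (Nat.card (AddAut L₀) : ℚ)) := by
  have hu : IsIsogeny (autToIntertwiners eL eM hc hD) :=
    ⟨finite_ker_autToIntertwiners eL eM hc hD, finiteIndex_range_autToIntertwiners eL eM hc hk hD⟩
  obtain ⟨h1, h2, h3⟩ := index_of_surjective_of_injective (l := endFst c) (r := endSnd c)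
    (autFreeRep_surjective eL) (autFreeRep_surjective eM) (intertwinersFst_injective hd)
    (intertwinersSnd_injective hd) (finiteIndex_range_intertwinersFst hd)
    (index_range_intertwiners d) hu rfl rfl
  rw [card_ker_autFreeRep, card_ker_autFreeRep] at h3
  push_cast at h3
  exact ⟨⟨h1, h2⟩, h3⟩

end AutIndex

/-! ### Diagonalising injective endomorphisms of `ℤ^ι`. -/

section SmithNormalForm

variable {ι : Type*} [Fintype ι] [DecidableEq ι]

/-- Every injective endomorphism of `ℤ^ι` is diagonal in suitable bases of source and target. -/
theorem exists_diagonal_of_injective (D : (ι → ℤ) →ₗ[ℤ] (ι → ℤ)) (hD : Function.Injective D) :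
    ∃ (p q : (ι → ℤ) ≃ₗ[ℤ] (ι → ℤ)) (d : ι → ℤ), (∀ i, d i ≠ 0) ∧
      ∀ v, (Matrix.diagonal d).mulVec (p v) = q (D v) := by
  obtain ⟨b, d, b', h⟩ := Submodule.exists_smith_normal_form_of_rank_eq (N := LinearMap.range D)
    (Pi.basisFun ℤ ι) (LinearMap.finrank_range_of_inj hD)
  -- Pulling the adapted basis of the range back along `D` gives the source basis.
  let p := b'.map (LinearEquiv.ofInjective D hD).symm
  have hp : ∀ i, D (p i) = d i • b i := fun i => by
    rw [← h]
    exact congrArg Subtype.val ((LinearEquiv.ofInjective D hD).apply_symm_apply (b' i))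
  refine ⟨p.equivFun, b.equivFun, d, fun i hi => b'.ne_zero i ?_, fun v => ?_⟩
  · rw [← Subtype.coe_inj, h, hi, zero_smul]
    rfl
  · have : (Matrix.diagonal d).mulVecLin ∘ₗ p.equivFun.toLinearMap =
        b.equivFun.toLinearMap ∘ₗ D := by
      refine p.ext fun i => ?_
      simp only [LinearMap.comp_apply, LinearEquiv.coe_coe, hp, map_smul, Matrix.mulVecLin_apply]
      ext j
      rw [Matrix.mulVec_diagonal]
      by_cases hij : i = j
      · subst hij; simp
      · simp [hij]
    exact LinearMap.congr_fun this v

end SmithNormalForm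

/-! ### Existence of commensurabilities, adapted splittings and the index formula. -/

section Main

theorem isAddIsogeny_freeIncl {ι A A₀ : Type*} [AddCommGroup A] [AddCommGroup A₀] [Finite A₀]
    (e : A ≃+ (ι → ℤ) × A₀) : IsAddIsogeny (freeIncl e) := by
  constructor
  · have : (freeIncl e).ker = ⊥ := (AddMonoidHom.ker_eq_bot_iff _).2
      (Function.LeftInverse.injective (freePart_freeIncl e))
    rw [this]
    infer_instance
  · let q : A →+ A₀ := (AddMonoidHom.snd _ _).comp e.toAddMonoidHom
    have : q.ker.FiniteIndex := inferInstance
    refine AddSubgroup.finiteIndex_of_le (H := q.ker) fun x hx => ⟨freePart e x, ?_⟩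
    have h : (e x).2 = 0 := hx
    conv_rhs => rw [eq_freeIncl_add e x, h]
    rw [← Prod.zero_eq_mk, map_zero, add_zero]

theorem exists_commensurability {ι : Type*} [Fintype ι] {L M : Type u} [AddCommGroup L]
    [AddCommGroup M] {L₀ M₀ : Type*} [AddCommGroup L₀] [AddCommGroup M₀] [Finite L₀] [Finite M₀]
    (eL : L ≃+ (ι → ℤ) × L₀) (eM : M ≃+ (ι → ℤ) × M₀) :
    ∃ c : AbCorrespondence L M, c.IsCommensurability := by
  -- The middle group must live in `Type u`, whatever the universe of `ι`.
  let b : ULift.{u} (Fin (Fintype.card ι) → ℤ) ≃+ (ι → ℤ) :=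
    AddEquiv.ulift.trans (LinearEquiv.funCongrLeft ℤ ℤ (Fintype.equivFin ι)).toAddEquiv
  have h : ∀ {A : Type u} [AddCommGroup A] {f : (ι → ℤ) →+ A}, IsAddIsogeny f →
      IsAddIsogeny (f.comp b.toAddMonoidHom) := by
    rintro A _ f ⟨h1, h2⟩
    refine ⟨?_, ?_⟩
    · have : Finite b.toAddMonoidHom.ker := by
        rw [(AddMonoidHom.ker_eq_bot_iff _).2 b.injective]
        infer_instance
      exact finite_ker_comp b.toAddMonoidHom f
    · rwa [AddMonoidHom.range_comp, AddMonoidHom.range_eq_top.2 b.surjective,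
        ← AddMonoidHom.range_eq_map]
  exact ⟨⟨_, _, _⟩, h (isAddIsogeny_freeIncl eL), h (isAddIsogeny_freeIncl eM)⟩

variable {ι : Type*} [Fintype ι] [DecidableEq ι] {L M : Type u} [AddCommGroup L] [AddCommGroup M]
  {L₀ M₀ : Type*} [AddCommGroup L₀] [AddCommGroup M₀] [Finite L₀] [Finite M₀]

theorem map_eq_zero_of_mem_finite {ι A : Type*} [AddCommGroup A] (H : AddSubgroup A) [Finite H]
    (φ : A →+ (ι → ℤ)) {x : A} (hx : x ∈ H) : φ x = 0 :=
  map_eq_zero_of_finite (φ.comp H.subtype) ⟨x, hx⟩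

/-- With `a`, `b` the maps from `c.W` to the two free parts and `t` satisfying `a ∘ t = m`, the
injective endomorphism `b ∘ t` represents `m` times the rational isomorphism. Its diagonalising base
changes are absorbed into the splittings, and `k = m`. -/
theorem exists_diagonal (eL : L ≃+ (ι → ℤ) × L₀) (eM : M ≃+ (ι → ℤ) × M₀)
    {c : AbCorrespondence L M} (hc : c.IsCommensurability) :
    ∃ (eL' : L ≃+ (ι → ℤ) × L₀) (eM' : M ≃+ (ι → ℤ) × M₀) (d : ι → ℤ) (k : ℤ),
      (∀ i, d i ≠ 0) ∧ k ≠ 0 ∧ ∀ w, (Matrix.diagonal d).mulVec (freePart eL' (c.left w)) =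
        k • freePart eM' (c.right w) := by
  obtain ⟨m, t, hm, ht⟩ := exists_lift_smul hc.1.2 (freeIncl eL)
  have hmZ : (m : ℤ) ≠ 0 := by exact_mod_cast hm
  have := hc.1.1
  have := hc.2.1
  have := finite_ker_freePart eL
  have := finite_ker_freePart eM
  let a : c.W →+ (ι → ℤ) := (freePart eL).comp c.left
  let b : c.W →+ (ι → ℤ) := (freePart eM).comp c.right
  have := finite_ker_comp c.left (freePart eL)
  have := finite_ker_comp c.right (freePart eM)
  have hat : ∀ v, a (t v) = (m : ℤ) • v := fun v => by
    change freePart eL (c.left (t v)) = _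
    rw [ht, map_zsmul, freePart_freeIncl]
  -- The difference `t (a w) - m • w` lies in the finite group `a.ker`, which `b` must kill.
  have hba : ∀ w, b (t (a w)) = (m : ℤ) • b w := fun w => by
    rw [← map_zsmul, ← sub_eq_zero, ← map_sub]
    refine map_eq_zero_of_mem_finite a.ker b ?_
    rw [AddMonoidHom.mem_ker, map_sub, hat, map_zsmul, sub_self]
  have hinj : Function.Injective (b.comp t).toIntLinearMap := by
    rw [injective_iff_map_eq_zero]
    intro v hv
    have h1 : a (t v) = 0 := map_eq_zero_of_mem_finite b.ker a hv
    rw [hat] at h1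
    exact (smul_eq_zero.1 h1).resolve_left hmZ
  obtain ⟨p, q, d, hd, h⟩ := exists_diagonal_of_injective _ hinj
  refine ⟨eL.trans (p.toAddEquiv.prodCongr (AddEquiv.refl _)),
    eM.trans (q.toAddEquiv.prodCongr (AddEquiv.refl _)), d, m, hd, hmZ, fun w => ?_⟩
  change (Matrix.diagonal d).mulVec (p (a w)) = (m : ℤ) • q (b w)
  rw [h, ← map_zsmul q, ← hba]
  rfl

theorem aut_index [AddGroup.FG L] (eL : L ≃+ (ι → ℤ) × L₀) (eM : M ≃+ (ι → ℤ) × M₀)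
    {c : AbCorrespondence L M} (hc : c.IsCommensurability) :
    c.aut.IsCommensurability ∧ c.aut.index =
      ((Nat.card M₀ : ℚ) ^ Fintype.card ι * (Nat.card (AddAut M₀) : ℚ)) /
        ((Nat.card L₀ : ℚ) ^ Fintype.card ι * (Nat.card (AddAut L₀) : ℚ)) := by
  obtain ⟨eL', eM', d, k, hd, hk, hD⟩ := exists_diagonal eL eM hc
  exact aut_index_of_diagonal eL' eM' hc hd hk hD

theorem finrank_eq_zero_of_finite (A : Type*) [AddCommGroup A] [Finite A] :
    Module.finrank ℤ A = 0 := by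
  refine Module.finrank_eq_zero_iff.2 fun x => ⟨Nat.card A, ?_, ?_⟩
  · exact_mod_cast Nat.card_pos.ne'
  · rw [natCast_zsmul, card_nsmul_eq_zero']

theorem IsAddIsogeny.finrank_eq {A B : Type*} [AddCommGroup A] [AddCommGroup B] [AddGroup.FG B]
    {f : A →+ B} (hf : IsAddIsogeny f) : Module.finrank ℤ A = Module.finrank ℤ B := by
  have := hf.1
  have := hf.2
  have := moduleFinite_of_finite_ker f
  have : Module.Finite ℤ B := Module.Finite.iff_addGroup_fg.2 inferInstance
  let F := f.toIntLinearMap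
  have hk : Finite (LinearMap.ker F) := inferInstanceAs (Finite f.ker)
  have hq : Finite (B ⧸ LinearMap.range F) := inferInstanceAs (Finite (B ⧸ f.range))
  rw [← Submodule.finrank_quotient_add_finrank (LinearMap.ker F),
    ← Submodule.finrank_quotient_add_finrank (LinearMap.range F), finrank_eq_zero_of_finite (LinearMap.ker F),
    finrank_eq_zero_of_finite (B ⧸ LinearMap.range F), add_zero, zero_add, F.quotKerEquivRange.finrank_eq]

theorem exists_splitting (A : Type*) [AddCommGroup A] [AddGroup.FG A] :
    ∃ (A₀ : Type) (_ : AddCommGroup A₀) (_ : Finite A₀),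
      Nonempty (A ≃+ (Fin (Module.finrank ℤ A) → ℤ) × A₀) := by
  obtain ⟨n, ι, _, p, hp, e, ⟨f⟩⟩ := AddCommGroup.equiv_free_prod_directSum_zmod A
  have : ∀ i, NeZero (p i ^ e i) := fun i => ⟨pow_ne_zero _ (hp i).ne_zero⟩
  have : Finite (DirectSum ι fun i => ZMod (p i ^ e i)) := by
    classical
    exact Finite.of_equiv _ (DirectSum.addEquivProd fun i => ZMod (p i ^ e i)).symm.toEquiv
  let g := f.trans ((Finsupp.linearEquivFunOnFinite ℤ ℤ (Fin n)).toAddEquiv.prodCongr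
    (AddEquiv.refl _))
  -- The inclusion of `ℤⁿ` is an isogeny, and isogenies preserve rank.
  have hn : n = Module.finrank ℤ A := by
    rw [← (isAddIsogeny_freeIncl g).finrank_eq, Module.finrank_fin_fun]
  subst hn
  exact ⟨_, inferInstance, this, ⟨g⟩⟩

theorem exists_commensurability_iff [AddGroup.FG L] [AddGroup.FG M] :
    (∃ c : AbCorrespondence L M, c.IsCommensurability) ↔
      Module.finrank ℤ L = Module.finrank ℤ M := by
  constructor
  · rintro ⟨c, h1, h2⟩
    rw [← h1.finrank_eq, ← h2.finrank_eq]
  · intro h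
    obtain ⟨L₀, _, _, ⟨eL⟩⟩ := exists_splitting L
    obtain ⟨M₀, _, _, ⟨eM⟩⟩ := exists_splitting M
    rw [h] at eL
    exact exists_commensurability eL eM

theorem ia_eq_choose (h : ∃ c : AbCorrespondence L M, c.IsCommensurability) :
    ia L M = h.choose.aut.index := dif_pos h

end Main

end Commens

theorem mainTheorem10 (L M : Type u) [AddCommGroup L] [AddCommGroup M]
    [AddGroup.FG L] [AddGroup.FG M] :
    ((∃ c : Commens.AbCorrespondence L M, c.IsCommensurability) ↔
      Module.finrank ℤ L = Module.finrank ℤ M) ∧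
    ∀ (n : ℕ) (L₀ M₀ : Type*) [AddCommGroup L₀] [AddCommGroup M₀] [Finite L₀] [Finite M₀],
      Nonempty (L ≃+ (Fin n → ℤ) × L₀) → Nonempty (M ≃+ (Fin n → ℤ) × M₀) →
        (∀ c : Commens.AbCorrespondence L M, c.IsCommensurability →
          c.aut.IsCommensurability ∧ c.aut.index = Commens.ia L M) ∧
        Commens.ia L M =
          ((Nat.card M₀ : ℚ) ^ n * (Nat.card (AddAut M₀) : ℚ)) /
            ((Nat.card L₀ : ℚ) ^ n * (Nat.card (AddAut L₀) : ℚ)) := by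
  refine ⟨Commens.exists_commensurability_iff, ?_⟩
  rintro n L₀ M₀ _ _ _ _ ⟨eL⟩ ⟨eM⟩
  have h := Commens.exists_commensurability eL eM
  have key := Commens.aut_index eL eM h.choose_spec
  rw [Fintype.card_fin] at key
  rw [Commens.ia_eq_choose h]
  refine ⟨fun c hc => ?_, key.2⟩
  -- The formula holds for every `c`, in particular for the one chosen in `ia`; this gives
  -- independence of the choice.
  have hc' := Commens.aut_index eL eM hc
  rw [Fintype.card_fin] at hc'
  exact ⟨hc'.1, hc'.2.trans key.2.symm⟩
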